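/- Let $p$ be a prime and let $X=\Omega_p$ be the additive topological group of the field of $p$-adic numbers. Let $\alpha$ be a topological automorphism of $X$, written as multiplication by $p^k c$, where $k\in\mathbb{Z}$ and $c=\sum_{n\ge 0}c_np^n$ with $c_n\in\{0,1,\dots,p-1\}$, $c_0\neq 0$, is a unit of the ring of $p$-adic integers. For a compact subgroup $K$ of $X$ let $m_K$ be the normalized Haar measure of $K$, regarded as a probability distribution on $X$, and for $x\in X$ let $E_x$ be the unit mass at $x$. A distribution on $X$ is called idempotent if it has the form $m_K*E_x$ with $K$ a compact subgroup of $X$ and $x\in X$, and degenerate if it equals $E_x$ for some $x\in X$. The conditional distribution of a random variable $L_2$ given $L_1$ is called symmetric if, for almost every value of $L_1$, the conditional distribution of $L_2$ given that value is invariant under $y\mapsto -y$. Then the following statements hold. 1. Let $\xi_1$ and $\xi_2$ be independent random variables with values in $X$ and distributions $\mu_1$ and $\mu_2$. Assume that the conditional distribution of $L_2=\xi_1+\alpha\xi_2$ given $L_1=\xi_1+\xi_2$ is symmetric. (i) If $p>2$, $k=0$ and $c_0\neq p-1$, then there are a compact subgroup $K$ of $X$ and $x_1,x_2\in X$ such that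 $\mu_1=m_K*E_{x_1}$ and $\mu_2=m_K*E_{x_2}$. Moreover, if $c_0=1$, then $\mu_1$ and $\mu_2$ are degenerate. (ii) If $p=2$, $k=0$, $c_0=1$ and $c_1=0$, then $\mu_1$ and $\mu_2$ are degenerate. (iii) If $p>2$ and $|k|=1$, then at least one of $\mu_1$, $\mu_2$ is idempotent. 2. If one of the following conditions holds: (i) $p>2$, $k=0$, $c_0=p-1$; (ii) $p=2$, $k=0$, $c_0=c_1=1$; (iii) $p=2$, $|k|=1$; (iv) $p\ge 2$, $|k|\ge 2$, then there exist independent random variables $\xi_1$ and $\xi_2$ with values in $X$ and distributions $\mu_1$ and $\mu_2$ such that the conditional distribution of $L_2=\xi_1+\alpha\xi_2$ given $L_1=\xi_1+\xi_2$ is symmetric, whereas neither $\mu_1$ nor $\mu_2$ is idempotent. -/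

import Mathlib

open MeasureTheory ProbabilityTheory TopologicalSpace

noncomputable section

/-- The Borel σ-algebra on the additive group of `p`-adic numbers. -/
instance Padic.instMeasurableSpaceBorel (p : ℕ) [Fact p.Prime] : MeasurableSpace ℚ_[p] :=
  borel ℚ_[p]

instance Padic.instBorelSpaceBorel (p : ℕ) [Fact p.Prime] : BorelSpace ℚ_[p] :=
  ⟨rfl⟩

/-- The `n`-th digit `xₙ ∈ {0, …, p - 1}` of the `p`-adic integer `x = ∑ₙ xₙ pⁿ`: the residue
`x mod p^(n+1)` in `{0, …, p^(n+1) - 1}` is `x₀ + x₁ p + ⋯ + xₙ pⁿ`, and its quotient by `pⁿ`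
is `xₙ`. -/
def padicDigit {p : ℕ} [Fact p.Prime] (x : ℤ_[p]) (n : ℕ) : ℕ :=
  (PadicInt.toZModPow (n + 1) x).val / p ^ n

section Distributions

variable {X : Type*} [AddCommGroup X] [TopologicalSpace X] [IsTopologicalAddGroup X]
  [MeasurableSpace X] [BorelSpace X]

/-- The Haar distribution `m_K` of a compact subgroup `K` of `X`: the Haar measure of the group `K`
with total mass one, regarded as a distribution on `X`. -/
def haarDistribution (K : AddSubgroup X) [CompactSpace K] : Measure X :=
  (Measure.addHaarMeasure (⊤ : PositiveCompacts K)).map ((↑) : K → X)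

/-- A distribution is idempotent if it is a shift `m_K * E_x` of the Haar distribution of a compact
subgroup `K` (`E_x` being the unit mass at `x`). -/
def IsIdempotentDistribution (μ : Measure X) : Prop :=
  ∃ (K : AddSubgroup X) (_ : CompactSpace K) (x : X), μ = haarDistribution K ∗ Measure.dirac x

/-- A distribution is degenerate if it is concentrated at a single point. -/
def IsDegenerateDistribution (μ : Measure X) : Prop :=
  ∃ x : X, μ = Measure.dirac x

end Distributions

/-- The conditional distribution of `L₂` given `L₁` is symmetric: for almost every value `x` of
`L₁`, the regular conditional distribution of `L₂` given `L₁ = x` is invariant under `y ↦ -y`. -/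
def HasSymmetricCondDistrib {Ω X : Type*} [MeasurableSpace Ω] [AddCommGroup X] [MeasurableSpace X]
    [StandardBorelSpace X] (P : Measure Ω) [IsFiniteMeasure P] (L₂ L₁ : Ω → X) : Prop :=
  ∀ᵐ x ∂(P.map L₁), (condDistrib L₂ L₁ P x).map (fun y => -y) = condDistrib L₂ L₁ P x

end

noncomputable section

open scoped BoundedContinuousFunction

/-! A character of `ℚ_[p]` trivial exactly on the `p`-adic integers among balls around `0`
identifies the group with its dual. Symmetry says that `(L₁, L₂)` and `(L₁, -L₂)` have the same law.
By independence this is the equation f(u+v) g(u+av) = f(u-v) g(u-av) for the characteristic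
functions f, g, where a is the multiplier of α (`hasSymmetricCondDistrib_iff_padicCharFun`).

For part 1, pass to the moduli F, G and put κ = (1-a)/(1+a). The choices u = v and u = -av give
G(κv) = G(v) F(2v/(1+a)) and F(κv) = F(v) G(2av/(1+a)), so F and G do not increase under κ. If |κ| <
1, iteration and continuity at 0 force F = G = 1. If |κ| = 1, powers of κ accumulate at 1, so the
inequalities are equalities, and F or G equals 1 wherever the other one, suitably rescaled, is
nonzero. A characteristic function with moduli 0 and 1 only is that of a shifted Haar distribution
(`eq_haarDistribution_conv_dirac`).

For part 2, one function suffices: 1 on the open unit ball, 1/2 on the units, 0 elsewhere. It is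
even and depends only on residues, which solves the equation for the listed a (after a dilation by p
of one of the two distributions when |k| ≥ 2). The value 1/2 excludes idempotence. -/

/-! ### A character for the self-duality of the `p`-adic numbers. -/

theorem exists_padic_addChar (p : ℕ) [Fact p.Prime] :
    ∃ e : AddChar ℚ_[p] Circle, (∀ x, ‖x‖ ≤ 1 → e x = 1) ∧ e ((p : ℚ_[p])⁻¹) ≠ 1 := by
  let Z : AddSubgroup ℚ_[p] := (PadicInt.subring p).toAddSubgroup
  have hp : (p : ℚ_[p])⁻¹ ∉ Z := by
    change ¬ ‖(p : ℚ_[p])⁻¹‖ ≤ 1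
    rw [norm_inv, Padic.norm_p, inv_inv, not_le]
    exact_mod_cast (Fact.out : p.Prime).one_lt
  -- Homomorphisms into ℚ/ℤ separate the points of any abelian group; `j` below embeds ℚ/ℤ into ℝ/ℤ,
  -- which maps onto the circle.
  obtain ⟨χ, hχ⟩ := CharacterModule.exists_character_apply_ne_zero_of_ne_zero
    (A := ℚ_[p] ⧸ Z) (a := QuotientAddGroup.mk (p : ℚ_[p])⁻¹)
    (by rwa [Ne, QuotientAddGroup.eq_zero_iff])
  let j : AddCircle (1 : ℚ) →+ AddCircle (1 : ℝ) :=
    QuotientAddGroup.map _ _ (Rat.castHom ℝ : ℚ →+* ℝ).toAddMonoidHom (by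
      rw [AddSubgroup.zmultiples_le]
      simp)
  have hj : Function.Injective j := by
    rw [injective_iff_map_eq_zero]
    intro x hx
    induction x using QuotientAddGroup.induction_on with
    | H x =>
      rw [QuotientAddGroup.map_mk, QuotientAddGroup.eq_zero_iff] at hx
      obtain ⟨n, hn⟩ := AddSubgroup.mem_zmultiples_iff.1 hx
      rw [QuotientAddGroup.eq_zero_iff]
      refine AddSubgroup.mem_zmultiples_iff.2 ⟨n, ?_⟩
      simp at hn ⊢
      exact_mod_cast hn
  let e : AddChar ℚ_[p] Circle :=
    { toFun := fun x => AddCircle.toCircle (j (χ (QuotientAddGroup.mk x)))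
      map_zero_eq_one' := by
        rw [QuotientAddGroup.mk_zero, map_zero, map_zero, AddCircle.toCircle_zero]
      map_add_eq_mul' := fun x y => by
        rw [QuotientAddGroup.mk_add, map_add, map_add, AddCircle.toCircle_add] }
  refine ⟨e, fun x hx => ?_, fun h => hχ ?_⟩
  · change AddCircle.toCircle (j (χ (QuotientAddGroup.mk x))) = 1
    rw [(QuotientAddGroup.eq_zero_iff x).2 (show x ∈ Z from hx), map_zero, map_zero,
      AddCircle.toCircle_zero]
  · rw [← AddCircle.toCircle_zero (T := (1 : ℝ))] at h
    refine hj ?_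
    rw [map_zero]
    exact AddCircle.injective_toCircle one_ne_zero h

/-- A character of `ℚ_[p]` which is trivial on `ℤ_[p]` but not on `p⁻¹ ℤ_[p]`. -/
def padicChar (p : ℕ) [Fact p.Prime] : AddChar ℚ_[p] Circle :=
  (exists_padic_addChar p).choose

section Character

variable {p : ℕ} [Fact p.Prime]

theorem padicChar_eq_one {x : ℚ_[p]} (hx : ‖x‖ ≤ 1) : padicChar p x = 1 :=
  (exists_padic_addChar p).choose_spec.1 x hx

theorem padicChar_inv_ne_one : padicChar p (p : ℚ_[p])⁻¹ ≠ 1 :=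
  (exists_padic_addChar p).choose_spec.2

theorem continuous_padicChar : Continuous (padicChar p) := by
  refine IsLocallyConstant.continuous ?_
  rw [IsLocallyConstant.iff_eventually_eq]
  intro x
  filter_upwards [Metric.ball_mem_nhds x one_pos] with y hy
  have h : padicChar p (y - x) = 1 := padicChar_eq_one (by
    rw [← dist_eq_norm]; exact (Metric.mem_ball.1 hy).le)
  rw [AddChar.map_sub_eq_div, div_eq_one] at h
  exact h

theorem Padic.norm_le_inv_of_norm_lt_one {x : ℚ_[p]} (hx : ‖x‖ < 1) : ‖x‖ ≤ (p : ℝ)⁻¹ := by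
  have := (Padic.norm_le_pow_iff_norm_lt_pow_add_one x (-1)).2 (by simpa using hx)
  simpa using this

/-- Every element of norm greater than one has a multiple on which the character is nontrivial. -/
theorem exists_padicChar_mul_ne_one {x : ℚ_[p]} (hx : 1 < ‖x‖) :
    ∃ z : ℚ_[p], ‖z‖ ≤ 1 ∧ padicChar p (x * z) ≠ 1 := by
  have hx0 : x ≠ 0 := by rintro rfl; simp at hx; linarith
  refine ⟨(p : ℚ_[p])⁻¹ / x, ?_, ?_⟩
  · have h1 : ‖x⁻¹‖ ≤ (p : ℝ)⁻¹ := Padic.norm_le_inv_of_norm_lt_one (by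
      rw [norm_inv]; exact inv_lt_one_of_one_lt₀ hx)
    have hp : (0 : ℝ) < p := by exact_mod_cast (Fact.out : p.Prime).pos
    rw [div_eq_mul_inv, norm_mul, norm_inv (p : ℚ_[p]), Padic.norm_p, inv_inv]
    calc (p : ℝ) * ‖x⁻¹‖ ≤ p * (p : ℝ)⁻¹ := by gcongr
      _ = 1 := mul_inv_cancel₀ hp.ne'
  · rw [mul_div_cancel₀ _ hx0]
    exact padicChar_inv_ne_one

theorem exists_padicChar_mul_ne_one_of_ne_zero {x : ℚ_[p]} (hx : x ≠ 0) :
    ∃ z : ℚ_[p], padicChar p (x * z) ≠ 1 :=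
  ⟨(p : ℚ_[p])⁻¹ / x, by rw [mul_div_cancel₀ _ hx]; exact padicChar_inv_ne_one⟩

end Character

/-! ### Characters determine finite measures. -/

/-- A set of bounded continuous functions closed under multiplication and conjugation and
separating points determines finite measures. -/
theorem MeasureTheory.Measure.ext_of_integral_eq_of_submonoid {E : Type*} [MeasurableSpace E]
    [PseudoEMetricSpace E] [BorelSpace E] [CompleteSpace E] [SecondCountableTopology E]
    {P Q : Measure E} [IsFiniteMeasure P] [IsFiniteMeasure Q] (S : Submonoid (E →ᵇ ℂ))
    (hstar : ∀ f ∈ S, star f ∈ S) (hsep : ∀ x y : E, x ≠ y → ∃ f ∈ S, f x ≠ f y)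
    (h : ∀ f ∈ S, ∫ x, f x ∂P = ∫ x, f x ∂Q) : P = Q := by
  let A : StarSubalgebra ℂ (E →ᵇ ℂ) := StarAlgebra.adjoin ℂ (S : Set (E →ᵇ ℂ))
  have hS : (S : Set (E →ᵇ ℂ)) ∪ star (S : Set (E →ᵇ ℂ)) = S := by
    refine Set.union_eq_left.2 fun f hf => ?_
    have := hstar _ (Set.mem_star.1 hf)
    rwa [star_star] at this
  refine ext_of_forall_mem_subalgebra_integral_eq_of_pseudoEMetric_complete_countable
    (𝕜 := ℂ) (A := A) ?_ ?_
  · intro x y hxy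
    obtain ⟨f, hf, hne⟩ := hsep x y hxy
    refine ⟨f, ⟨BoundedContinuousFunction.toContinuousMapStarₐ ℂ f, ⟨f, ?_, rfl⟩, rfl⟩, hne⟩
    exact StarAlgebra.subset_adjoin ℂ _ hf
  · intro g hg
    -- The star algebra generated by a star-closed monoid is its linear span, so linearity reduces
    -- the claim to members of `S`.
    have hg' : g ∈ Submodule.span ℂ (S : Set (E →ᵇ ℂ)) := by
      have h1 : g ∈ Subalgebra.toSubmodule (Algebra.adjoin ℂ (S : Set (E →ᵇ ℂ))) := by
        rw [← hS]; exact hg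
      rwa [Algebra.adjoin_eq_span, Submonoid.closure_eq] at h1
    clear hg
    induction hg' using Submodule.span_induction with
    | mem f hf => exact h f hf
    | zero => simp
    | add f g _ _ hf hg =>
      simp only [BoundedContinuousFunction.coe_add, Pi.add_apply]
      rw [integral_add (f.integrable P) (g.integrable P),
        integral_add (f.integrable Q) (g.integrable Q), hf, hg]
    | smul c f _ hf =>
      simp only [BoundedContinuousFunction.coe_smul]
      rw [integral_smul, integral_smul, hf]

/-- Finite measures are determined by the integrals of the characters `x ↦ e (l x)`, where `l` runs
over a point-separating space of continuous functions with values in `ℚ_[p]`. -/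
theorem MeasureTheory.Measure.ext_of_integral_padicChar {p : ℕ} [Fact p.Prime] {E : Type*}
    [MeasurableSpace E] [PseudoEMetricSpace E] [BorelSpace E] [CompleteSpace E]
    [SecondCountableTopology E] {P Q : Measure E} [IsFiniteMeasure P] [IsFiniteMeasure Q]
    (A : Submodule ℚ_[p] (E → ℚ_[p])) (hA : ∀ l ∈ A, Continuous l)
    (hsep : ∀ x y : E, x ≠ y → ∃ l ∈ A, l x ≠ l y)
    (h : ∀ l ∈ A, ∫ x, (padicChar p (l x) : ℂ) ∂P = ∫ x, (padicChar p (l x) : ℂ) ∂Q) :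
    P = Q := by
  let S : Submonoid (E →ᵇ ℂ) :=
    { carrier := {f | ∃ l ∈ A, ∀ x, f x = padicChar p (l x)}
      mul_mem' := by
        rintro f g ⟨l, hl, hf⟩ ⟨m, hm, hg⟩
        refine ⟨l + m, A.add_mem hl hm, fun x => ?_⟩
        simp [hf, hg, AddChar.map_add_eq_mul]
      one_mem' := ⟨0, A.zero_mem, fun x => by simp⟩ }
  refine Measure.ext_of_integral_eq_of_submonoid S ?_ ?_ ?_
  · rintro f ⟨l, hl, hf⟩
    refine ⟨-l, A.neg_mem hl, fun x => ?_⟩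
    simp [hf, AddChar.map_neg_eq_inv, ← Circle.coe_inv_eq_conj]
  · intro x y hxy
    obtain ⟨l, hl, hne⟩ := hsep x y hxy
    obtain ⟨z, hz⟩ := exists_padicChar_mul_ne_one_of_ne_zero (sub_ne_zero.2 hne)
    have hcont : Continuous fun x => (padicChar p ((z • l) x) : ℂ) :=
      continuous_subtype_val.comp (continuous_padicChar.comp (hA _ (A.smul_mem z hl)))
    refine ⟨BoundedContinuousFunction.ofNormedAddCommGroup _ hcont 1
        (fun x => (Circle.norm_coe _).le),
      ⟨z • l, A.smul_mem z hl, fun x => rfl⟩, fun heq => hz ?_⟩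
    have heq' : padicChar p (z * l x) = padicChar p (z * l y) := Circle.ext heq
    rw [mul_comm, mul_sub, AddChar.map_sub_eq_div, heq', div_self']
  · rintro f ⟨l, hl, hf⟩
    simpa only [hf] using h l hl

/-! ### Characteristic functions and Haar distributions of compact subgroups. -/

section CharFun

variable {p : ℕ} [Fact p.Prime]

theorem continuous_padicChar_coe : Continuous fun x : ℚ_[p] => (padicChar p x : ℂ) :=
  continuous_subtype_val.comp continuous_padicChar

/-- The characteristic function of a distribution on `ℚ_[p]`. -/
def padicCharFun (μ : Measure ℚ_[p]) (y : ℚ_[p]) : ℂ :=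
  ∫ x, (padicChar p (x * y) : ℂ) ∂μ

theorem integrable_padicChar {Ω : Type*} [MeasurableSpace Ω] (P : Measure Ω) [IsFiniteMeasure P]
    {ξ : Ω → ℚ_[p]} (hξ : Measurable ξ) : Integrable (fun ω => (padicChar p (ξ ω) : ℂ)) P :=
  Integrable.of_bound (continuous_padicChar_coe.measurable.comp hξ).aestronglyMeasurable 1
    (Filter.Eventually.of_forall fun _ => (Circle.norm_coe _).le)

theorem padicCharFun_map {Ω : Type*} [MeasurableSpace Ω] (P : Measure Ω) {ξ : Ω → ℚ_[p]}
    (hξ : Measurable ξ) (y : ℚ_[p]) :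
    padicCharFun (P.map ξ) y = ∫ ω, (padicChar p (ξ ω * y) : ℂ) ∂P := by
  rw [padicCharFun, integral_map hξ.aemeasurable]
  exact (continuous_padicChar_coe.comp (continuous_id.mul continuous_const)).aestronglyMeasurable

theorem padicCharFun_zero (μ : Measure ℚ_[p]) [IsProbabilityMeasure μ] : padicCharFun μ 0 = 1 := by
  simp [padicCharFun]

theorem padicCharFun_neg (μ : Measure ℚ_[p]) (y : ℚ_[p]) :
    padicCharFun μ (-y) = (starRingEnd ℂ) (padicCharFun μ y) := by
  rw [padicCharFun, padicCharFun, ← integral_conj]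
  simp [AddChar.map_neg_eq_inv, ← Circle.coe_inv_eq_conj]

theorem norm_padicCharFun_neg (μ : Measure ℚ_[p]) (y : ℚ_[p]) :
    ‖padicCharFun μ (-y)‖ = ‖padicCharFun μ y‖ := by
  rw [padicCharFun_neg, RCLike.norm_conj]

theorem norm_padicCharFun_le_one (μ : Measure ℚ_[p]) [IsProbabilityMeasure μ] (y : ℚ_[p]) :
    ‖padicCharFun μ y‖ ≤ 1 := by
  simpa [padicCharFun] using norm_integral_le_of_norm_le_const (μ := μ)
    (f := fun x => (padicChar p (x * y) : ℂ)) (C := 1)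
    (Filter.Eventually.of_forall fun _ => (Circle.norm_coe _).le)

theorem continuous_padicCharFun (μ : Measure ℚ_[p]) [IsProbabilityMeasure μ] :
    Continuous (padicCharFun μ) := by
  refine continuous_of_dominated (bound := fun _ => 1) ?_
    (fun _ => Filter.Eventually.of_forall fun _ => (Circle.norm_coe _).le) (by simp) ?_
  · exact fun y => (continuous_padicChar_coe.comp (by fun_prop)).aestronglyMeasurable
  · exact Filter.Eventually.of_forall fun x => continuous_padicChar_coe.comp (by fun_prop)

theorem padicCharFun_conv_dirac (μ : Measure ℚ_[p]) [IsProbabilityMeasure μ] (x y : ℚ_[p]) :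
    padicCharFun (μ ∗ Measure.dirac x) y = padicCharFun μ y * padicChar p (x * y) := by
  have h : μ ∗ Measure.dirac x = μ.map (fun t => t + x) := by
    rw [Measure.conv, Measure.prod_dirac, Measure.map_map (by fun_prop) (by fun_prop)]
    rfl
  rw [h, padicCharFun_map _ (by fun_prop), padicCharFun, ← integral_mul_const]
  simp [add_mul, AddChar.map_add_eq_mul]

theorem integral_padicChar_prod (μ ν : Measure ℚ_[p]) [SFinite μ] [SFinite ν] (u v : ℚ_[p]) :
    ∫ x, (padicChar p (x.1 * u + x.2 * v) : ℂ) ∂(μ.prod ν) =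
      padicCharFun μ u * padicCharFun ν v := by
  simp only [AddChar.map_add_eq_mul, Circle.coe_mul]
  exact integral_prod_mul (fun x => (padicChar p (x * u) : ℂ)) (fun x => (padicChar p (x * v) : ℂ))

theorem ext_of_padicCharFun {μ ν : Measure ℚ_[p]} [IsFiniteMeasure μ] [IsFiniteMeasure ν]
    (h : ∀ y, padicCharFun μ y = padicCharFun ν y) : μ = ν := by
  refine Measure.ext_of_integral_padicChar (Submodule.span ℚ_[p] {fun x => x}) ?_ ?_ ?_
  · intro l hl
    obtain ⟨a, rfl⟩ := Submodule.mem_span_singleton.1 hl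
    exact continuous_const.smul continuous_id
  · exact fun x y hxy => ⟨_, Submodule.mem_span_singleton_self _, hxy⟩
  · intro l hl
    obtain ⟨a, rfl⟩ := Submodule.mem_span_singleton.1 hl
    simpa [padicCharFun, mul_comm] using h a

theorem ext_of_integral_padicChar_prod {P Q : Measure (ℚ_[p] × ℚ_[p])} [IsFiniteMeasure P]
    [IsFiniteMeasure Q]
    (h : ∀ u v : ℚ_[p], ∫ x, (padicChar p (x.1 * u + x.2 * v) : ℂ) ∂P =
      ∫ x, (padicChar p (x.1 * u + x.2 * v) : ℂ) ∂Q) : P = Q := by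
  refine Measure.ext_of_integral_padicChar (Submodule.span ℚ_[p] {Prod.fst, Prod.snd}) ?_ ?_ ?_
  · intro l hl
    obtain ⟨a, b, rfl⟩ := Submodule.mem_span_pair.1 hl
    exact (continuous_const.smul continuous_fst).add (continuous_const.smul continuous_snd)
  · intro x y hxy
    by_contra! hcon
    exact hxy (Prod.ext (hcon Prod.fst (Submodule.subset_span (by simp)))
      (hcon Prod.snd (Submodule.subset_span (by simp))))
  · intro l hl
    obtain ⟨a, b, rfl⟩ := Submodule.mem_span_pair.1 hl
    simpa [mul_comm] using h a b

/-- If the characteristic function has modulus one at `y`, then the character of `y` is almost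
surely constant. -/
theorem ae_eq_of_norm_padicCharFun_eq_one {μ : Measure ℚ_[p]} [IsProbabilityMeasure μ] {y : ℚ_[p]}
    (hy : ‖padicCharFun μ y‖ = 1) : ∀ᵐ x ∂μ, (padicChar p (x * y) : ℂ) = padicCharFun μ y := by
  -- Strict convexity of the disc: an average of unit complex numbers has modulus one only if they
  -- almost surely coincide.
  rcases ae_eq_const_or_norm_integral_lt_of_norm_le_const (μ := μ)
    (f := fun x => (padicChar p (x * y) : ℂ)) (C := 1)
    (Filter.Eventually.of_forall fun _ => (Circle.norm_coe _).le) with h | h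
  · rw [average_eq_integral] at h
    exact h
  · rw [padicCharFun] at hy
    simp [hy] at h

/-- Since the character of `y` is almost surely constant, the value at `n * y` is the `n`-th power
of the value at `y`. Natural numbers are dense in `ℤ_[p]`, and the condition on `z` is closed. -/
theorem norm_padicCharFun_mul_eq_one {μ : Measure ℚ_[p]} [IsProbabilityMeasure μ] {y z : ℚ_[p]}
    (hy : ‖padicCharFun μ y‖ = 1) (hz : ‖z‖ ≤ 1) : ‖padicCharFun μ (z * y)‖ = 1 := by
  have hclosed : IsClosed {z : ℤ_[p] | ‖padicCharFun μ (z * y)‖ = 1} := by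
    refine isClosed_eq ?_ continuous_const
    exact continuous_norm.comp ((continuous_padicCharFun μ).comp
      (continuous_subtype_val.mul continuous_const))
  have hnat : ∀ n : ℕ, (n : ℤ_[p]) ∈ {z : ℤ_[p] | ‖padicCharFun μ (z * y)‖ = 1} := by
    intro n
    have h : padicCharFun μ (((n : ℤ_[p]) : ℚ_[p]) * y) = padicCharFun μ y ^ n := by
      calc padicCharFun μ (((n : ℤ_[p]) : ℚ_[p]) * y)
          = ∫ _, padicCharFun μ y ^ n ∂μ := by
            refine integral_congr_ae ?_
            filter_upwards [ae_eq_of_norm_padicCharFun_eq_one hy] with x hx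
            rw [← hx, ← Circle.coe_pow, ← AddChar.map_nsmul_eq_pow]
            congr 2
            simp
            ring
        _ = padicCharFun μ y ^ n := by simp
    simp only [Set.mem_ofPred_eq]
    rw [h, norm_pow, hy, one_pow]
  have : (⟨z, hz⟩ : ℤ_[p]) ∈ {z : ℤ_[p] | ‖padicCharFun μ (z * y)‖ = 1} :=
    hclosed.closure_subset_iff.2 (Set.range_subset_iff.2 hnat) (PadicInt.denseRange_natCast _)
  exact this

/-- The annihilator of a set with respect to the self-duality of `ℚ_[p]`. -/
def padicAnnihilator (S : Set ℚ_[p]) : AddSubgroup ℚ_[p] where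
  carrier := {x | ∀ y ∈ S, padicChar p (x * y) = 1}
  zero_mem' := by simp
  add_mem' := fun ha hb y hy => by
    rw [add_mul, AddChar.map_add_eq_mul, ha y hy, hb y hy, one_mul]
  neg_mem' := fun ha y hy => by
    rw [neg_mul, AddChar.map_neg_eq_inv, ha y hy, inv_one]

theorem mem_padicAnnihilator {S : Set ℚ_[p]} {x : ℚ_[p]} :
    x ∈ padicAnnihilator S ↔ ∀ y ∈ S, padicChar p (x * y) = 1 := Iff.rfl

instance isProbabilityMeasure_haarDistribution (K : AddSubgroup ℚ_[p]) [CompactSpace K] :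
    IsProbabilityMeasure (haarDistribution K) := by
  have : IsProbabilityMeasure (Measure.addHaarMeasure (⊤ : PositiveCompacts K)) :=
    ⟨Measure.addHaarMeasure_self⟩
  exact Measure.isProbabilityMeasure_map measurable_subtype_coe.aemeasurable

theorem padicCharFun_haarDistribution_eq_one (K : AddSubgroup ℚ_[p]) [CompactSpace K] {y : ℚ_[p]}
    (hy : ∀ x ∈ K, padicChar p (x * y) = 1) : padicCharFun (haarDistribution K) y = 1 := by
  have : IsProbabilityMeasure (Measure.addHaarMeasure (⊤ : PositiveCompacts K)) :=
    ⟨Measure.addHaarMeasure_self⟩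
  rw [haarDistribution, padicCharFun_map _ measurable_subtype_coe]
  simp [hy]

/-- Translating by `x` preserves Haar measure but multiplies the integral by a number other than
one. -/
theorem padicCharFun_haarDistribution_eq_zero (K : AddSubgroup ℚ_[p]) [CompactSpace K]
    {x y : ℚ_[p]} (hx : x ∈ K) (hxy : padicChar p (x * y) ≠ 1) :
    padicCharFun (haarDistribution K) y = 0 := by
  rw [haarDistribution, padicCharFun_map _ measurable_subtype_coe]
  have h := integral_add_right_eq_self (μ := Measure.addHaarMeasure (⊤ : PositiveCompacts K))
    (fun t : K => (padicChar p (t * y) : ℂ)) ⟨x, hx⟩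
  simp only [AddSubgroup.coe_add, add_mul, AddChar.map_add_eq_mul, Circle.coe_mul] at h
  rw [integral_mul_const] at h
  by_contra h0
  exact hxy (Circle.ext (by simpa using mul_left_cancel₀ h0 (h.trans (mul_one _).symm)))

/-- As `S` contains all integral multiples of `y`, an annihilating `x` must satisfy ‖x * y‖ ≤ 1; the
annihilator is therefore bounded as well as closed. -/
theorem compactSpace_padicAnnihilator {S : Set ℚ_[p]} (hS : ∀ y ∈ S, ∀ z : ℚ_[p], ‖z‖ ≤ 1 → z * y ∈ S)
    {y : ℚ_[p]} (hy : y ∈ S) (hy0 : y ≠ 0) : CompactSpace (padicAnnihilator S) := by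
  have hclosed : IsClosed (padicAnnihilator S : Set ℚ_[p]) := by
    have : (padicAnnihilator S : Set ℚ_[p]) = ⋂ y ∈ S, {x | padicChar p (x * y) = 1} := by
      ext x; simp [mem_padicAnnihilator]
    rw [this]
    refine isClosed_biInter fun y _ => isClosed_eq ?_ continuous_const
    exact continuous_padicChar.comp (continuous_id.mul continuous_const)
  refine isCompact_iff_compactSpace.1 (Metric.isCompact_of_isClosed_isBounded hclosed ?_)
  refine (Metric.isBounded_closedBall (x := (0 : ℚ_[p])) (r := ‖y‖⁻¹)).subset fun x hx => ?_
  rw [mem_closedBall_zero_iff, ← one_div, le_div_iff₀ (norm_pos_iff.2 hy0), ← norm_mul]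
  by_contra! hlt
  obtain ⟨z, hz, hne⟩ := exists_padicChar_mul_ne_one hlt
  refine hne ?_
  have := mem_padicAnnihilator.1 hx _ (hS y hy z hz)
  rwa [show x * y * z = x * (z * y) by ring]

/-- A set stable under `ℤ_[p]` contains everything no larger than one of its elements. So a `y`
outside `S` exceeds all of `S` in norm, and `p⁻¹ / y` annihilates `S` but not `y`. -/
theorem padicCharFun_haarDistribution_padicAnnihilator_eq_zero {S : Set ℚ_[p]}
    [CompactSpace (padicAnnihilator S)] (h0 : (0 : ℚ_[p]) ∈ S)
    (hS : ∀ y ∈ S, ∀ z : ℚ_[p], ‖z‖ ≤ 1 → z * y ∈ S) {y : ℚ_[p]} (hy : y ∉ S) :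
    padicCharFun (haarDistribution (padicAnnihilator S)) y = 0 := by
  have hy0 : y ≠ 0 := by
    rintro rfl
    exact hy h0
  refine padicCharFun_haarDistribution_eq_zero _ (x := (p : ℚ_[p])⁻¹ / y) ?_ ?_
  · refine mem_padicAnnihilator.2 fun s hs => padicChar_eq_one ?_
    have hlt : ‖s‖ < ‖y‖ := by
      by_contra! hle
      have hs0 : s ≠ 0 := fun h0 => by
        rw [h0, norm_zero] at hle
        exact hy0 (norm_le_zero_iff.1 hle)
      refine hy ?_
      have := hS s hs (y / s) (by
        rw [norm_div]; exact div_le_one_of_le₀ hle (norm_nonneg _))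
      rwa [div_mul_cancel₀ _ hs0] at this
    have hp : (0 : ℝ) < p := by exact_mod_cast (Fact.out : p.Prime).pos
    have h1 : ‖s / y‖ ≤ (p : ℝ)⁻¹ := Padic.norm_le_inv_of_norm_lt_one (by
      rw [norm_div]; exact (div_lt_one (norm_pos_iff.2 hy0)).2 hlt)
    rw [show (p : ℚ_[p])⁻¹ / y * s = (p : ℚ_[p])⁻¹ * (s / y) by ring, norm_mul, norm_inv,
      Padic.norm_p, inv_inv]
    calc (p : ℝ) * ‖s / y‖ ≤ p * (p : ℝ)⁻¹ := by gcongr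
      _ = 1 := mul_inv_cancel₀ hp.ne'
  · rw [div_mul_cancel₀ _ hy0]
    exact padicChar_inv_ne_one

/-- A distribution whose characteristic function has modulus `0` or `1` everywhere is a shift of
the Haar distribution of the annihilator of the set where the modulus is `1`. -/
theorem eq_haarDistribution_conv_dirac {μ : Measure ℚ_[p]} [IsProbabilityMeasure μ]
    (h : ∀ y, padicCharFun μ y ≠ 0 → ‖padicCharFun μ y‖ = 1) :
    ∃ (_ : CompactSpace (padicAnnihilator {y | ‖padicCharFun μ y‖ = 1})) (x : ℚ_[p]),
      μ = haarDistribution (padicAnnihilator {y | ‖padicCharFun μ y‖ = 1}) ∗ Measure.dirac x := by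
  set S : Set ℚ_[p] := {y | ‖padicCharFun μ y‖ = 1} with hSdef
  have hS : ∀ y ∈ S, ∀ z : ℚ_[p], ‖z‖ ≤ 1 → z * y ∈ S := fun y hy z hz =>
    norm_padicCharFun_mul_eq_one hy hz
  -- Continuity at 0 makes the function nonzero, hence of modulus one, at some nonzero point.
  obtain ⟨y₀, hy₀, hy₀0⟩ : ∃ y ∈ S, y ≠ 0 := by
    have hnhds : {y | padicCharFun μ y ≠ 0} ∈ nhds (0 : ℚ_[p]) :=
      (isOpen_ne_fun (continuous_padicCharFun μ) continuous_const).mem_nhds (by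
        simp [padicCharFun_zero])
    obtain ⟨r, hr, hball⟩ := Metric.mem_nhds_iff.1 hnhds
    obtain ⟨y, hy0, hy⟩ := NormedField.exists_norm_lt ℚ_[p] hr
    exact ⟨y, h y (hball (by simpa using hy)), norm_pos_iff.1 hy0⟩
  have hK := compactSpace_padicAnnihilator hS hy₀ hy₀0
  refine ⟨hK, ?_⟩
  -- Each `y` has its own null set. A countable dense subset allows a single `x₀` to be chosen, and
  -- continuity then extends the identity to `S`.
  obtain ⟨D, hDS, hDc, hD⟩ := (IsSeparable.of_separableSpace S).exists_countable_dense_subset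
  obtain ⟨x₀, hx₀⟩ : ∃ x₀, ∀ y ∈ D, (padicChar p (x₀ * y) : ℂ) = padicCharFun μ y := by
    refine Filter.Eventually.exists (f := ae μ) ((ae_ball_iff hDc).2 fun y hy => ?_)
    exact ae_eq_of_norm_padicCharFun_eq_one (hDS hy)
  have hx₀S : ∀ y ∈ S, (padicChar p (x₀ * y) : ℂ) = padicCharFun μ y := by
    have hcl : IsClosed {y | (padicChar p (x₀ * y) : ℂ) = padicCharFun μ y} :=
      isClosed_eq (continuous_padicChar_coe.comp (by fun_prop)) (continuous_padicCharFun μ)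
    exact fun y hy => closure_minimal hx₀ hcl (hD hy)
  refine ⟨x₀, ext_of_padicCharFun fun y => ?_⟩
  rw [padicCharFun_conv_dirac]
  by_cases hy : y ∈ S
  · rw [padicCharFun_haarDistribution_eq_one _ fun x hx => mem_padicAnnihilator.1 hx y hy, one_mul,
      hx₀S y hy]
  · have hy0 : padicCharFun μ y = 0 := by
      by_contra h0
      exact hy (h y h0)
    rw [padicCharFun_haarDistribution_padicAnnihilator_eq_zero
      (by simp [hSdef, padicCharFun_zero]) hS hy, zero_mul, hy0]

/-- A distribution whose characteristic function has modulus `1` everywhere is degenerate. -/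
theorem isDegenerateDistribution_of_norm_padicCharFun_eq_one {μ : Measure ℚ_[p]}
    [IsProbabilityMeasure μ] (h : ∀ y, ‖padicCharFun μ y‖ = 1) : IsDegenerateDistribution μ := by
  obtain ⟨hK, x, hx⟩ := eq_haarDistribution_conv_dirac (μ := μ) fun y _ => h y
  refine ⟨x, ext_of_padicCharFun fun y => ?_⟩
  rw [hx, padicCharFun_conv_dirac, padicCharFun_haarDistribution_eq_one _
    fun t ht => mem_padicAnnihilator.1 ht y (h y), one_mul, padicCharFun, integral_dirac]

theorem IsIdempotentDistribution.norm_padicCharFun {μ : Measure ℚ_[p]}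
    (hμ : IsIdempotentDistribution μ) (y : ℚ_[p]) :
    ‖padicCharFun μ y‖ = 0 ∨ ‖padicCharFun μ y‖ = 1 := by
  obtain ⟨K, hK, x, rfl⟩ := hμ
  rw [padicCharFun_conv_dirac, norm_mul, Circle.norm_coe, mul_one]
  by_cases hy : ∀ t ∈ K, padicChar p (t * y) = 1
  · right
    rw [padicCharFun_haarDistribution_eq_one K hy, norm_one]
  · left
    push Not at hy
    obtain ⟨t, ht, hty⟩ := hy
    rw [padicCharFun_haarDistribution_eq_zero K ht hty, norm_zero]

end CharFun

/-! ### From symmetric conditional distributions to the Heyde functional equation. -/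

/-- The conditional distribution of `L₂` given `L₁` is symmetric if and only if the pairs
`(L₁, L₂)` and `(L₁, -L₂)` are identically distributed. -/
theorem hasSymmetricCondDistrib_iff_map_eq {Ω X : Type*} [MeasurableSpace Ω] [AddCommGroup X]
    [MeasurableSpace X] [MeasurableNeg X] [StandardBorelSpace X] (P : Measure Ω)
    [IsFiniteMeasure P] {L₁ L₂ : Ω → X} (h₂ : Measurable L₂) :
    HasSymmetricCondDistrib P L₂ L₁ ↔
      P.map (fun ω => (L₁ ω, -L₂ ω)) = P.map (fun ω => (L₁ ω, L₂ ω)) := by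
  -- The conditional law of `-L₂` is the reflected conditional law of `L₂`, and the joint law
  -- determines conditional laws almost everywhere.
  have hneg := condDistrib_comp (mβ := inferInstance) (μ := P) L₁ h₂.aemeasurable (measurable_neg (G := X))
  have hiff := condDistrib_ae_eq_iff_measure_eq_compProd (mβ := inferInstance) (μ := P) L₁
    (measurable_neg.comp h₂).aemeasurable (condDistrib L₂ L₁ P)
  rw [compProd_map_condDistrib h₂.aemeasurable] at hiff
  refine Iff.trans ?_ hiff
  constructor
  · intro h
    filter_upwards [h, hneg] with x hx hx'
    rw [hx', Kernel.map_apply _ measurable_neg]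
    exact hx
  · intro h
    filter_upwards [h, hneg] with x hx hx'
    rw [hx', Kernel.map_apply _ measurable_neg] at hx
    exact hx

section Heyde

variable {p : ℕ} [Fact p.Prime]

/-- The Heyde functional equation. -/
theorem hasSymmetricCondDistrib_iff_padicCharFun {Ω : Type*} [MeasurableSpace Ω] (P : Measure Ω)
    [IsProbabilityMeasure P] {ξ₁ ξ₂ : Ω → ℚ_[p]} (h₁ : Measurable ξ₁) (h₂ : Measurable ξ₂)
    (hind : IndepFun ξ₁ ξ₂ P) (a : ℚ_[p]) :
    HasSymmetricCondDistrib P (fun ω => ξ₁ ω + a * ξ₂ ω) (fun ω => ξ₁ ω + ξ₂ ω) ↔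
      ∀ u v, padicCharFun (P.map ξ₁) (u + v) * padicCharFun (P.map ξ₂) (u + a * v) =
        padicCharFun (P.map ξ₁) (u - v) * padicCharFun (P.map ξ₂) (u - a * v) := by
  have key : ∀ u v, ∫ ω, (padicChar p (ξ₁ ω * u + ξ₂ ω * v) : ℂ) ∂P =
      padicCharFun (P.map ξ₁) u * padicCharFun (P.map ξ₂) v := by
    intro u v
    have := Measure.isProbabilityMeasure_map (μ := P) h₁.aemeasurable
    have := Measure.isProbabilityMeasure_map (μ := P) h₂.aemeasurable
    rw [← integral_padicChar_prod,
      ← (indepFun_iff_map_prod_eq_prod_map_map h₁.aemeasurable h₂.aemeasurable).1 hind,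
      integral_map (h₁.prodMk h₂).aemeasurable]
    exact (continuous_padicChar_coe.comp (by fun_prop)).aestronglyMeasurable
  have h₃ : Measurable fun ω => ξ₁ ω + ξ₂ ω := h₁.add h₂
  have h₄ : Measurable fun ω => ξ₁ ω + a * ξ₂ ω := h₁.add (h₂.const_mul a)
  have h₅ : Measurable fun ω => -(ξ₁ ω + a * ξ₂ ω) := h₄.neg
  have hcont : ∀ u v : ℚ_[p], Continuous fun x : ℚ_[p] × ℚ_[p] =>
      (padicChar p (x.1 * u + x.2 * v) : ℂ) :=
    fun u v => continuous_padicChar_coe.comp (by fun_prop)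
  -- Regrouping the exponent by `ξ₁` and `ξ₂` makes the transform of the joint law factor; `hneg` is
  -- the same computation with `v` replaced by `-v`.
  have hpos : ∀ u v, ∫ x, (padicChar p (x.1 * u + x.2 * v) : ℂ)
      ∂(P.map fun ω => (ξ₁ ω + ξ₂ ω, ξ₁ ω + a * ξ₂ ω)) =
      padicCharFun (P.map ξ₁) (u + v) * padicCharFun (P.map ξ₂) (u + a * v) := by
    intro u v
    rw [integral_map (h₃.prodMk h₄).aemeasurable (hcont u v).aestronglyMeasurable, ← key]
    refine integral_congr_ae (Filter.Eventually.of_forall fun ω => ?_)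
    exact congrArg (fun t => (padicChar p t : ℂ)) (by ring)
  have hneg : ∀ u v, ∫ x, (padicChar p (x.1 * u + x.2 * v) : ℂ)
      ∂(P.map fun ω => (ξ₁ ω + ξ₂ ω, -(ξ₁ ω + a * ξ₂ ω))) =
      padicCharFun (P.map ξ₁) (u - v) * padicCharFun (P.map ξ₂) (u - a * v) := by
    intro u v
    rw [integral_map (h₃.prodMk h₅).aemeasurable (hcont u v).aestronglyMeasurable, ← key]
    refine integral_congr_ae (Filter.Eventually.of_forall fun ω => ?_)
    exact congrArg (fun t => (padicChar p t : ℂ)) (by ring)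
  rw [hasSymmetricCondDistrib_iff_map_eq P h₄]
  constructor
  · intro h u v
    rw [← hpos, ← hneg, h]
  · intro h
    have := Measure.isProbabilityMeasure_map (μ := P) (h₃.prodMk h₄).aemeasurable
    have := Measure.isProbabilityMeasure_map (μ := P) (h₃.prodMk h₅).aemeasurable
    exact ext_of_integral_padicChar_prod fun u v => by rw [hpos, hneg, h]

/-- Some sequence of powers of a `p`-adic unit, with positive exponents, tends to one. -/
theorem exists_tendsto_pow_one {x : ℚ_[p]} (hx : ‖x‖ = 1) :
    ∃ m : ℕ → ℕ, (∀ n, 0 < m n) ∧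
      Filter.Tendsto (fun n => x ^ m n) Filter.atTop (nhds 1) := by
  have hp := (Fact.out : p.Prime)
  obtain ⟨u, rfl⟩ : ∃ u : ℤ_[p]ˣ, ((u : ℤ_[p]) : ℚ_[p]) = x :=
    ⟨PadicInt.mkUnits hx, PadicInt.mkUnits_eq hx⟩
  -- By Euler's theorem the power with exponent φ(p^n) is 1 modulo p^n.
  refine ⟨fun n => Nat.totient (p ^ n), fun n => Nat.totient_pos.2 (pow_pos hp.pos n), ?_⟩
  rw [tendsto_iff_norm_sub_tendsto_zero]
  have hbound : ∀ n : ℕ, ‖((u : ℤ_[p]) : ℚ_[p]) ^ Nat.totient (p ^ n) - 1‖ ≤ ((p : ℝ)⁻¹) ^ n := by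
    intro n
    have hmem : (u : ℤ_[p]) ^ Nat.totient (p ^ n) - 1 ∈
        (Ideal.span {(p : ℤ_[p]) ^ n} : Ideal ℤ_[p]) := by
      rw [← PadicInt.ker_toZModPow, RingHom.mem_ker, map_sub, map_pow, map_one, sub_eq_zero]
      have := congrArg Units.val
        (ZMod.pow_totient (Units.map (PadicInt.toZModPow (p := p) n : ℤ_[p] →* ZMod (p ^ n)) u))
      simp only [Units.val_pow_eq_pow_val, Units.coe_map, Units.val_one] at this
      exact this
    have := (PadicInt.norm_le_pow_iff_mem_span_pow _ n).2 hmem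
    simpa [PadicInt.norm_def] using this
  refine squeeze_zero (fun _ => norm_nonneg _) hbound (tendsto_pow_atTop_nhds_zero_of_lt_one
    (by positivity) (inv_lt_one_of_one_lt₀ (by exact_mod_cast hp.one_lt)))

/-! ### Consequences of the equation for the moduli. -/

/-- The properties of the moduli of two characteristic functions satisfying the Heyde functional
equation with coefficient `a`. -/
structure HeydePair (a : ℚ_[p]) (F G : ℚ_[p] → ℝ) : Prop where
  continuous_left : Continuous F
  continuous_right : Continuous G
  zero_left : F 0 = 1
  zero_right : G 0 = 1
  neg_left : ∀ v, F (-v) = F v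
  neg_right : ∀ v, G (-v) = G v
  nonneg_left : ∀ v, 0 ≤ F v
  nonneg_right : ∀ v, 0 ≤ G v
  le_one_left : ∀ v, F v ≤ 1
  le_one_right : ∀ v, G v ≤ 1
  mul_left : ∀ v z, F v = 1 → ‖z‖ ≤ 1 → F (z * v) = 1
  mul_right : ∀ v z, G v = 1 → ‖z‖ ≤ 1 → G (z * v) = 1
  eq : ∀ u v, F (u + v) * G (u + a * v) = F (u - v) * G (u - a * v)

theorem heydePair_norm_padicCharFun {a : ℚ_[p]} {μ ν : Measure ℚ_[p]} [IsProbabilityMeasure μ]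
    [IsProbabilityMeasure ν]
    (h : ∀ u v, padicCharFun μ (u + v) * padicCharFun ν (u + a * v) =
      padicCharFun μ (u - v) * padicCharFun ν (u - a * v)) :
    HeydePair a (fun y => ‖padicCharFun μ y‖) (fun y => ‖padicCharFun ν y‖) where
  continuous_left := (continuous_padicCharFun μ).norm
  continuous_right := (continuous_padicCharFun ν).norm
  zero_left := by simp [padicCharFun_zero]
  zero_right := by simp [padicCharFun_zero]
  neg_left := norm_padicCharFun_neg μ
  neg_right := norm_padicCharFun_neg ν
  nonneg_left _ := norm_nonneg _
  nonneg_right _ := norm_nonneg _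
  le_one_left := norm_padicCharFun_le_one μ
  le_one_right := norm_padicCharFun_le_one ν
  mul_left _ _ := norm_padicCharFun_mul_eq_one
  mul_right _ _ := norm_padicCharFun_mul_eq_one
  eq u v := by simp only [← norm_mul, h]

namespace HeydePair

variable {a : ℚ_[p]} {F G : ℚ_[p] → ℝ}

/-- Substituting `a⁻¹ * v` for `v` exchanges the two functions; this reduces negative `k` to
positive `k`. -/
theorem symm (h : HeydePair a F G) (ha : a ≠ 0) : HeydePair a⁻¹ G F where
  continuous_left := h.continuous_right
  continuous_right := h.continuous_left
  zero_left := h.zero_right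
  zero_right := h.zero_left
  neg_left := h.neg_right
  neg_right := h.neg_left
  nonneg_left := h.nonneg_right
  nonneg_right := h.nonneg_left
  le_one_left := h.le_one_right
  le_one_right := h.le_one_left
  mul_left := h.mul_right
  mul_right := h.mul_left
  eq u v := by
    have := h.eq u (a⁻¹ * v)
    rw [mul_inv_cancel_left₀ ha] at this
    rw [mul_comm, this, mul_comm]

/-- Both arguments are taken equal to `v / (1 + a)`, which turns one factor into `F 0`. -/
theorem right_ratio_mul (h : HeydePair a F G) (ha : 1 + a ≠ 0) (v : ℚ_[p]) :
    G ((1 - a) / (1 + a) * v) = G v * F (2 / (1 + a) * v) := by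
  have := h.eq (v / (1 + a)) (v / (1 + a))
  rw [sub_self, h.zero_left, one_mul, mul_comm] at this
  convert this.symm using 3 <;> field_simp
  ring

/-- Here the first argument is `-a` times the second, which turns one factor into `G 0`. -/
theorem left_ratio_mul (h : HeydePair a F G) (ha : 1 + a ≠ 0) (v : ℚ_[p]) :
    F ((1 - a) / (1 + a) * v) = F v * G (2 * a / (1 + a) * v) := by
  have := h.eq (-(a * (v / (1 + a)))) (v / (1 + a))
  rw [neg_add_cancel, h.zero_right, mul_one] at this
  rw [← h.neg_left v, ← h.neg_right (2 * a / (1 + a) * v)]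
  convert this using 3 <;> field_simp <;> ring

/-- The ratio identities give H(κv) ≤ H(v) for both functions. Iterating, H(κ^n v) ≤ H(v), and the
left side tends to H(0) = 1. -/
theorem eq_one_of_norm_ratio_lt_one (h : HeydePair a F G) (ha : 1 + a ≠ 0)
    (hκ : ‖(1 - a) / (1 + a)‖ < 1) (v : ℚ_[p]) : F v = 1 ∧ G v = 1 := by
  have key : ∀ H : ℚ_[p] → ℝ, Continuous H → H 0 = 1 →
      (∀ v, H ((1 - a) / (1 + a) * v) ≤ H v) → 1 ≤ H v := by
    intro H hH h0 hle
    have hn : ∀ n : ℕ, H (((1 - a) / (1 + a)) ^ n * v) ≤ H v := by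
      intro n
      induction n with
      | zero => simp
      | succ n ih =>
        rw [pow_succ', mul_assoc]
        exact (hle _).trans ih
    have hlim : Filter.Tendsto (fun n : ℕ => H (((1 - a) / (1 + a)) ^ n * v)) Filter.atTop
        (nhds 1) := by
      have := (tendsto_pow_atTop_nhds_zero_of_norm_lt_one hκ).mul_const v
      rw [zero_mul] at this
      have := (hH.tendsto 0).comp this
      rwa [h0] at this
    exact le_of_tendsto' hlim hn
  constructor
  · refine le_antisymm (h.le_one_left v) (key F h.continuous_left h.zero_left fun v => ?_)
    rw [h.left_ratio_mul ha]
    exact mul_le_of_le_one_right (h.nonneg_left _) (h.le_one_right _)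
  · refine le_antisymm (h.le_one_right v) (key G h.continuous_right h.zero_right fun v => ?_)
    rw [h.right_ratio_mul ha]
    exact mul_le_of_le_one_right (h.nonneg_right _) (h.le_one_left _)

/-- Monotonicity along the orbit of a unit is equality: H(κ^m v) ≤ H(κv) for m ≥ 1, and suitable
powers κ^m tend to 1. -/
theorem _root_.eq_mul_of_le_of_norm_eq_one {H : ℚ_[p] → ℝ} (hH : Continuous H) {κ : ℚ_[p]}
    (hκ : ‖κ‖ = 1) (hle : ∀ v, H (κ * v) ≤ H v) (v : ℚ_[p]) : H (κ * v) = H v := by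
  refine le_antisymm (hle v) ?_
  obtain ⟨m, hm, hlim⟩ := exists_tendsto_pow_one hκ
  have hn : ∀ n : ℕ, H (κ ^ (n + 1) * v) ≤ H (κ * v) := by
    intro n
    induction n with
    | zero => simp
    | succ n ih =>
      rw [pow_succ', mul_assoc]
      exact (hle _).trans ih
  have hlim' := (hH.tendsto _).comp (hlim.mul_const v)
  rw [one_mul] at hlim'
  refine le_of_tendsto' hlim' fun n => ?_
  have := hn (m n - 1)
  rwa [Nat.sub_add_cancel (hm n)] at this

/-- G(κv) = G(v) allows G(v) to be cancelled in `right_ratio_mul`. -/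
theorem left_eq_one (h : HeydePair a F G) (ha : 1 + a ≠ 0) (hκ : ‖(1 - a) / (1 + a)‖ = 1)
    {v : ℚ_[p]} (hv : G v ≠ 0) : F (2 / (1 + a) * v) = 1 := by
  have h1 := eq_mul_of_le_of_norm_eq_one h.continuous_right hκ (fun v => by
    rw [h.right_ratio_mul ha]
    exact mul_le_of_le_one_right (h.nonneg_right _) (h.le_one_left _)) v
  rw [h.right_ratio_mul ha] at h1
  exact mul_left_cancel₀ hv (h1.trans (mul_one _).symm)

theorem right_eq_one (h : HeydePair a F G) (ha : 1 + a ≠ 0) (hκ : ‖(1 - a) / (1 + a)‖ = 1)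
    {v : ℚ_[p]} (hv : F v ≠ 0) : G (2 * a / (1 + a) * v) = 1 := by
  have h1 := eq_mul_of_le_of_norm_eq_one h.continuous_left hκ (fun v => by
    rw [h.left_ratio_mul ha]
    exact mul_le_of_le_one_right (h.nonneg_left _) (h.le_one_right _)) v
  rw [h.left_ratio_mul ha] at h1
  exact mul_left_cancel₀ hv (h1.trans (mul_one _).symm)

theorem left_eq_one_of_right_ne_zero (h : HeydePair a F G) (hκ : ‖(1 - a) / (1 + a)‖ = 1)
    (h2 : ‖2 / (1 + a)‖ = 1) {v : ℚ_[p]} (hv : G v ≠ 0) : F v = 1 := by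
  have ha : 1 + a ≠ 0 := fun h0 => by simp [h0] at h2
  have hne : 2 / (1 + a) ≠ 0 := norm_pos_iff.1 (h2 ▸ one_pos)
  have := h.mul_left _ (2 / (1 + a))⁻¹ (h.left_eq_one ha hκ hv) (by rw [norm_inv, h2, inv_one])
  rwa [inv_mul_cancel_left₀ hne] at this

/-- The multiplier 2a/(1+a) has norm ‖a‖, so `z` is an integral multiple of it. -/
theorem right_eq_one_of_left_ne_zero (h : HeydePair a F G) (hκ : ‖(1 - a) / (1 + a)‖ = 1)
    (h2 : ‖2 / (1 + a)‖ = 1) {v z : ℚ_[p]} (hz : ‖z‖ ≤ ‖a‖) (hv : F v ≠ 0) : G (z * v) = 1 := by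
  have ha : 1 + a ≠ 0 := fun h0 => by simp [h0] at h2
  have hne : 2 / (1 + a) ≠ 0 := norm_pos_iff.1 (h2 ▸ one_pos)
  rcases eq_or_ne a 0 with rfl | ha0
  · rw [norm_zero, norm_le_zero_iff] at hz
    rw [hz, zero_mul, h.zero_right]
  have := h.mul_right _ (z / (2 * a / (1 + a))) (h.right_eq_one ha hκ hv) (by
    rw [norm_div, mul_div_right_comm, norm_mul, h2, one_mul]
    exact div_le_one_of_le₀ hz (norm_nonneg _))
  rwa [← mul_assoc, div_mul_cancel₀] at this
  rw [mul_div_right_comm]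
  exact mul_ne_zero hne ha0

/-- Suppose `F` at `v` and `G` at `w` are both neither 0 nor 1. Then F(w) = 1, so ‖v‖ ≤ ‖w‖ would
give F(v) = 1. If ‖w‖ < ‖v‖, discreteness of the norm gives ‖w / v‖ ≤ p⁻¹ = ‖a‖, hence G(w) = 1. A
smaller ‖a‖ would leave a gap here. -/
theorem left_or_right_eq_one (h : HeydePair a F G) (hκ : ‖(1 - a) / (1 + a)‖ = 1)
    (h2 : ‖2 / (1 + a)‖ = 1) (ha : ‖a‖ = (p : ℝ)⁻¹) :
    (∀ v, F v ≠ 0 → F v = 1) ∨ (∀ v, G v ≠ 0 → G v = 1) := by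
  by_contra! hcon
  obtain ⟨⟨v, hv0, hv1⟩, w, hw0, hw1⟩ := hcon
  have hw := h.left_eq_one_of_right_ne_zero hκ h2 hw0
  rcases eq_or_ne w 0 with rfl | hwz
  · exact hw1 h.zero_right
  have hvz : v ≠ 0 := fun h0 => hv1 (by rw [h0, h.zero_left])
  rcases lt_or_ge ‖w‖ ‖v‖ with hlt | hle
  · refine hw1 ?_
    have := h.right_eq_one_of_left_ne_zero hκ h2 (z := w / v) (by
      rw [ha]
      refine Padic.norm_le_inv_of_norm_lt_one ?_
      rw [norm_div]
      exact (div_lt_one (norm_pos_iff.2 hvz)).2 hlt) hv0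
    rwa [div_mul_cancel₀ _ hvz] at this
  · refine hv1 ?_
    have := h.mul_left _ (v / w) hw (by
      rw [norm_div]; exact div_le_one_of_le₀ hle (norm_nonneg _))
    rwa [div_mul_cancel₀ _ hwz] at this

end HeydePair

end Heyde

/-! ### Digits and norms. -/

section Digits

variable {p : ℕ} [Fact p.Prime]

theorem PadicInt.val_toZModPow_eq_iff (x : ℤ_[p]) {n m : ℕ} (hm : m < p ^ n) :
    (PadicInt.toZModPow n x).val = m ↔ ‖x - m‖ ≤ (p : ℝ) ^ (-n : ℤ) := by
  have : NeZero (p ^ n) := ⟨(pow_pos (Fact.out : p.Prime).pos n).ne'⟩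
  rw [PadicInt.norm_le_pow_iff_mem_span_pow, ← PadicInt.ker_toZModPow, RingHom.mem_ker, map_sub,
    map_natCast, sub_eq_zero]
  constructor
  · rintro rfl
    rw [ZMod.natCast_zmod_val]
  · intro h
    rw [h, ZMod.val_natCast_of_lt hm]

theorem padicDigit_zero_eq_iff (x : ℤ_[p]) {m : ℕ} (hm : m < p) :
    padicDigit x 0 = m ↔ ‖(x : ℚ_[p]) - m‖ < 1 := by
  have h := PadicInt.val_toZModPow_eq_iff x (n := 1) (m := m) (by simpa using hm)
  have h' := Padic.norm_le_pow_iff_norm_lt_pow_add_one ((x : ℚ_[p]) - (m : ℚ_[p])) (-1)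
  rw [padicDigit, pow_zero, Nat.div_one, zero_add, h, PadicInt.norm_def]
  simpa using h'

theorem padicDigit_zero_eq_sub_one_iff (x : ℤ_[p]) :
    padicDigit x 0 = p - 1 ↔ ‖1 + (x : ℚ_[p])‖ < 1 := by
  have hp := (Fact.out : p.Prime)
  rw [padicDigit_zero_eq_iff x (Nat.sub_lt hp.pos one_pos), Nat.cast_sub hp.one_le, Nat.cast_one]
  constructor
  · intro h
    have := (Padic.nonarchimedean ((x : ℚ_[p]) - ((p : ℚ_[p]) - 1)) p).trans_lt
      (max_lt h Padic.norm_p_lt_one)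
    rwa [show (x : ℚ_[p]) - (p - 1) + p = 1 + x by ring] at this
  · intro h
    have := (Padic.nonarchimedean (1 + (x : ℚ_[p])) (-p)).trans_lt
      (max_lt h (by rw [norm_neg]; exact Padic.norm_p_lt_one))
    rwa [show 1 + (x : ℚ_[p]) + -p = x - (p - 1) by ring] at this

/-- The first two digits give the residue modulo 4. It is applied with `d = 0` for units near 1 and
`d = 1` for units near 3, that is, near -1. -/
theorem norm_sub_le_of_padicDigit (hp2 : p = 2) {x : ℤ_[p]} {d : ℕ} (h0 : padicDigit x 0 = 1)
    (h1 : padicDigit x 1 = d) : ‖(x : ℚ_[p]) - (1 + 2 * d)‖ ≤ 4⁻¹ := by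
  have : NeZero (p ^ 2) := ⟨(pow_pos (Fact.out : p.Prime).pos 2).ne'⟩
  set r := (PadicInt.toZModPow 2 x).val with hr
  have hrlt : r < p ^ 2 := ZMod.val_lt _
  have hrx : ‖(x : ℚ_[p]) - r‖ ≤ 4⁻¹ := by
    have := (PadicInt.val_toZModPow_eq_iff x hrlt).1 rfl
    rw [PadicInt.norm_def] at this
    refine le_of_le_of_eq (by simpa using this) ?_
    rw [hp2]; norm_num
  have hx1 := (padicDigit_zero_eq_iff x (Fact.out : p.Prime).one_lt).1 h0
  have hrd : r / 2 = d := by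
    rw [padicDigit, pow_one] at h1
    rw [← h1, hr]
    congr 1
    exact hp2.symm
  have hodd : r % 2 = 1 := by
    by_contra hne
    have hdvd : p ∣ r := by rw [hp2]; omega
    have hr1 : ‖(r : ℚ_[p])‖ < 1 := Padic.norm_natCast_lt_one_iff.2 hdvd
    have h1 : ‖(x : ℚ_[p])‖ < 1 := by
      have := (Padic.nonarchimedean ((x : ℚ_[p]) - (r : ℚ_[p])) r).trans_lt
        (max_lt (hrx.trans_lt (inv_lt_one_of_one_lt₀ (by norm_num))) hr1)
      rwa [sub_add_cancel] at this
    have := (Padic.nonarchimedean (x : ℚ_[p]) (-(x - ((1 : ℕ) : ℚ_[p])))).trans_lt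
      (max_lt h1 (by rwa [norm_neg]))
    simp at this
  rw [show (1 + 2 * d : ℚ_[p]) = ((r : ℕ) : ℚ_[p]) by
    rw [show r = 1 + 2 * d by omega]; push_cast; ring]
  exact hrx

theorem Padic.norm_two_eq_one (hp : 2 < p) : ‖(2 : ℚ_[p])‖ = 1 := by
  have := (Padic.norm_natCast_eq_one_iff (p := p) (n := 2)).2
    ((Nat.coprime_primes (Fact.out : p.Prime) Nat.prime_two).2 hp.ne')
  exact_mod_cast this

theorem Padic.norm_two_eq_inv (hp : p = 2) : ‖(2 : ℚ_[p])‖ = 2⁻¹ := by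
  subst hp
  exact_mod_cast Padic.norm_p (p := 2)

theorem Padic.norm_one_add_eq_one {x : ℚ_[p]} (hx : ‖x‖ < 1) : ‖1 + x‖ = 1 := by
  rw [Padic.add_eq_max_of_ne (by rw [norm_one]; exact hx.ne'), norm_one, max_eq_left hx.le]

theorem Padic.norm_one_sub_eq_one {x : ℚ_[p]} (hx : ‖x‖ < 1) : ‖1 - x‖ = 1 := by
  rw [sub_eq_add_neg]
  exact Padic.norm_one_add_eq_one (by rwa [norm_neg])

end Digits

/-! ### The coefficients of part 1. -/

namespace HeydePair

variable {p : ℕ} [Fact p.Prime] {a : ℚ_[p]} {F G : ℚ_[p] → ℝ}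

theorem eq_one_of_norm_one_sub_lt_one (h : HeydePair a F G) (h1a : ‖1 + a‖ = 1)
    (ha : ‖1 - a‖ < 1) (v : ℚ_[p]) : F v = 1 ∧ G v = 1 :=
  h.eq_one_of_norm_ratio_lt_one (norm_pos_iff.1 (h1a ▸ one_pos)) (by
    rwa [norm_div, h1a, div_one]) v

/-- Either ‖1 - a‖ < 1 and κ is a contraction, or κ, 2/(1+a) and a are all units. -/
theorem eq_one_of_norm_eq_one (h : HeydePair a F G) (hp : 2 < p) (ha : ‖a‖ = 1)
    (h1a : ‖1 + a‖ = 1) (v : ℚ_[p]) : (F v ≠ 0 → G v = 1) ∧ (G v ≠ 0 → F v = 1) := by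
  have hle : ‖1 - a‖ ≤ 1 := by
    have := Padic.nonarchimedean (1 : ℚ_[p]) (-a)
    rwa [norm_neg, norm_one, ha, max_self, ← sub_eq_add_neg] at this
  rcases hle.lt_or_eq with hlt | heq
  · have := h.eq_one_of_norm_one_sub_lt_one h1a hlt v
    exact ⟨fun _ => this.2, fun _ => this.1⟩
  · have hκ : ‖(1 - a) / (1 + a)‖ = 1 := by rw [norm_div, heq, h1a, div_one]
    have h2 : ‖2 / (1 + a)‖ = 1 := by rw [norm_div, Padic.norm_two_eq_one hp, h1a, div_one]
    refine ⟨fun hv => ?_, h.left_eq_one_of_right_ne_zero hκ h2⟩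
    have := h.right_eq_one_of_left_ne_zero hκ h2 (z := 1) (by rw [norm_one, ha]) hv
    rwa [one_mul] at this

theorem left_or_right_eq_one_of_norm_eq_inv (h : HeydePair a F G) (hp : 2 < p)
    (ha : ‖a‖ = (p : ℝ)⁻¹) :
    (∀ v, F v ≠ 0 → F v = 1) ∨ (∀ v, G v ≠ 0 → G v = 1) := by
  have hlt : ‖a‖ < 1 := by rw [ha, ← Padic.norm_p]; exact Padic.norm_p_lt_one
  refine h.left_or_right_eq_one ?_ ?_ ha
  · rw [norm_div, Padic.norm_one_add_eq_one hlt, Padic.norm_one_sub_eq_one hlt, div_one]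
  · rw [norm_div, Padic.norm_one_add_eq_one hlt, Padic.norm_two_eq_one hp, div_one]

/-- Although 1 + a is not a unit, ‖1 + a‖ = 1/2 still exceeds ‖1 - a‖ ≤ 1/4, so κ is a contraction.
-/
theorem eq_one_of_norm_sub_one_le (h : HeydePair a F G) (hp : p = 2) (ha : ‖a - 1‖ ≤ 4⁻¹)
    (v : ℚ_[p]) : F v = 1 ∧ G v = 1 := by
  have h2 := Padic.norm_two_eq_inv hp
  have h1a : ‖1 + a‖ = 2⁻¹ := by
    rw [show 1 + a = 2 + (a - 1) by ring, Padic.add_eq_max_of_ne, h2, max_eq_left]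
    · exact ha.trans (by norm_num)
    · rw [h2]
      intro h
      rw [← h] at ha
      norm_num at ha
  refine h.eq_one_of_norm_ratio_lt_one (norm_pos_iff.1 (h1a ▸ by norm_num)) ?_ v
  rw [norm_div, h1a, norm_sub_rev, div_lt_one (by norm_num)]
  exact ha.trans_lt (by norm_num)

end HeydePair

/-! ### Non-idempotent solutions for part 2. -/

section Examples

variable {p : ℕ} [Fact p.Prime]

theorem exists_padicCharFun_eq_ite {S : Set ℚ_[p]} (h0 : (0 : ℚ_[p]) ∈ S)
    (hS : ∀ y ∈ S, ∀ z : ℚ_[p], ‖z‖ ≤ 1 → z * y ∈ S) (hne : ∃ y ∈ S, y ≠ 0) :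
    ∃ μ : Measure ℚ_[p], IsProbabilityMeasure μ ∧
      (∀ y ∈ S, padicCharFun μ y = 1) ∧ ∀ y ∉ S, padicCharFun μ y = 0 := by
  obtain ⟨y₀, hy₀, hne⟩ := hne
  have := compactSpace_padicAnnihilator hS hy₀ hne
  exact ⟨haarDistribution (padicAnnihilator S), inferInstance,
    fun y hy => padicCharFun_haarDistribution_eq_one _ fun x hx => mem_padicAnnihilator.1 hx y hy,
    fun y hy => padicCharFun_haarDistribution_padicAnnihilator_eq_zero h0 hS hy⟩

/-- The half-sum of the Haar distributions of two balls: its characteristic function takes the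
value `1/2` on the units. -/
theorem exists_padicCharFun_eq_half (p : ℕ) [Fact p.Prime] :
    ∃ μ : Measure ℚ_[p], IsProbabilityMeasure μ ∧ (∀ y, ‖y‖ < 1 → padicCharFun μ y = 1) ∧
      (∀ y, ‖y‖ = 1 → padicCharFun μ y = 1 / 2) ∧ ∀ y, 1 < ‖y‖ → padicCharFun μ y = 0 := by
  obtain ⟨μ, hμ, hμ1, hμ0⟩ := exists_padicCharFun_eq_ite (p := p) (S := {y | ‖y‖ ≤ 1}) (by simp)
    (fun y (hy : ‖y‖ ≤ 1) z hz => show ‖z * y‖ ≤ 1 by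
      rw [norm_mul]; exact mul_le_one₀ hz (norm_nonneg _) hy)
    ⟨1, by simp, one_ne_zero⟩
  obtain ⟨ν, hν, hν1, hν0⟩ := exists_padicCharFun_eq_ite (p := p) (S := {y | ‖y‖ < 1}) (by simp)
    (fun y (hy : ‖y‖ < 1) z hz => show ‖z * y‖ < 1 by
      rw [norm_mul]; exact mul_lt_one_of_nonneg_of_lt_one_right hz (norm_nonneg _) hy)
    ⟨p, Padic.norm_p_lt_one, by exact_mod_cast (Fact.out : p.Prime).ne_zero⟩
  have key : ∀ y, padicCharFun ((2⁻¹ : ENNReal) • μ + (2⁻¹ : ENNReal) • ν) y =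
      1 / 2 * padicCharFun μ y + 1 / 2 * padicCharFun ν y := by
    intro y
    have hint : ∀ m : Measure ℚ_[p], IsProbabilityMeasure m →
        Integrable (fun x => (padicChar p (x * y) : ℂ)) m := fun m _ =>
      integrable_padicChar m (measurable_id.mul_const y)
    rw [padicCharFun, integral_add_measure ((hint μ hμ).smul_measure (by simp))
      ((hint ν hν).smul_measure (by simp)), integral_smul_measure, integral_smul_measure]
    simp [padicCharFun]
  refine ⟨(2⁻¹ : ENNReal) • μ + (2⁻¹ : ENNReal) • ν, ⟨?_⟩, fun y hy => ?_, fun y hy => ?_,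
    fun y hy => ?_⟩
  · simp [ENNReal.inv_two_add_inv_two]
  · rw [key, hμ1 y hy.le, hν1 y hy]
    norm_num
  · rw [key, hμ1 y hy.le, hν0 y (not_lt.2 hy.ge)]
    norm_num
  · rw [key, hμ0 y (not_le.2 hy), hν0 y (not_lt.2 hy.le)]
    norm_num

/-- Locally constant even functions supported on `ℤ_[p]`. -/
structure IsEvenOnResidues (φ : ℚ_[p] → ℂ) : Prop where
  neg : ∀ x, φ (-x) = φ x
  congr : ∀ x y, ‖x - y‖ < 1 → φ x = φ y
  norm_le : ∀ x, φ x ≠ 0 → ‖x‖ ≤ 1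

/-- The half-sum has a characteristic function depending only on the norm, which yields both
evenness and constancy on residue classes. -/
theorem exists_isEvenOnResidues_padicCharFun (p : ℕ) [Fact p.Prime] :
    ∃ μ : Measure ℚ_[p], IsProbabilityMeasure μ ∧ IsEvenOnResidues (padicCharFun μ) ∧
      padicCharFun μ 1 = 1 / 2 := by
  obtain ⟨μ, hμ, h1, h2, h3⟩ := exists_padicCharFun_eq_half p
  have hnorm : ∀ x y, ‖x‖ = ‖y‖ → padicCharFun μ x = padicCharFun μ y := by
    intro x y hxy
    rcases lt_trichotomy ‖x‖ 1 with h | h | h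
    · rw [h1 x h, h1 y (hxy ▸ h)]
    · rw [h2 x h, h2 y (hxy ▸ h)]
    · rw [h3 x h, h3 y (hxy ▸ h)]
  refine ⟨μ, hμ, ⟨fun x => hnorm _ _ (norm_neg x), fun x y hxy => ?_, fun x hx => ?_⟩,
    h2 1 norm_one⟩
  · rcases lt_or_ge ‖x‖ 1 with hx | hx
    · have hy : ‖y‖ < 1 := by
        have := (Padic.nonarchimedean (-(x - y)) x).trans_lt
          (max_lt (by rwa [norm_neg]) hx)
        rwa [show -(x - y) + x = y by ring] at this
      rw [h1 x hx, h1 y hy]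
    · refine hnorm _ _ ?_
      exact (Padic.norm_eq_of_norm_sub_lt_left (hxy.trans_le hx))
  · by_contra! hlt
    exact hx (h3 x hlt)

/-- A functional equation of Heyde type can be checked where one side does not vanish. -/
theorem mul_eq_mul_of_ne_zero {f g : ℚ_[p] → ℂ} {a : ℚ_[p]}
    (h : ∀ u v, f (u + v) ≠ 0 → g (u + a * v) ≠ 0 →
      f (u + v) * g (u + a * v) = f (u - v) * g (u - a * v)) (u v : ℚ_[p]) :
    f (u + v) * g (u + a * v) = f (u - v) * g (u - a * v) := by
  by_cases h1 : f (u + v) * g (u + a * v) = 0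
  · by_cases h2 : f (u - v) * g (u - a * v) = 0
    · rw [h1, h2]
    -- Replacing `v` by `-v` interchanges the two sides.
    · have := h u (-v)
      simp only [mul_neg, ← sub_eq_add_neg, sub_neg_eq_add] at this
      exact (this (left_ne_zero_of_mul h2) (right_ne_zero_of_mul h2)).symm
  · exact h u v (left_ne_zero_of_mul h1) (right_ne_zero_of_mul h1)

namespace IsEvenOnResidues

variable {φ : ℚ_[p] → ℂ} {a : ℚ_[p]}

theorem norm_one_sub_mul_le (hφ : IsEvenOnResidues φ) {u v : ℚ_[p]} (h1 : φ (u + v) ≠ 0)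
    (h2 : φ (u + a * v) ≠ 0) : ‖(1 - a) * v‖ ≤ 1 := by
  have := (Padic.nonarchimedean (u + v) (-(u + a * v))).trans
    (max_le (hφ.norm_le _ h1) (by rw [norm_neg]; exact hφ.norm_le _ h2))
  rwa [show u + v + -(u + a * v) = (1 - a) * v by ring] at this

/-- Where the left side is nonzero, (1-a)v is integral, so ‖(1+a)v‖ < 1. Then u + av and u - v have
the same value of φ, as do u - av and u + v: the two factors merely swap. -/
theorem heyde_eq_of_norm_one_add_lt (hφ : IsEvenOnResidues φ) (ha : ‖1 + a‖ < ‖1 - a‖)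
    (u v : ℚ_[p]) : φ (u + v) * φ (u + a * v) = φ (u - v) * φ (u - a * v) := by
  refine mul_eq_mul_of_ne_zero (fun u v h1 h2 => ?_) u v
  have hv := hφ.norm_one_sub_mul_le h1 h2
  have hlt : ‖(1 + a) * v‖ < 1 := by
    rcases eq_or_ne v 0 with rfl | hv0
    · simp
    · refine lt_of_lt_of_le ?_ hv
      rw [norm_mul, norm_mul]
      exact mul_lt_mul_of_pos_right ha (norm_pos_iff.2 hv0)
  rw [hφ.congr (u + a * v) (u - v) (by rwa [show u + a * v - (u - v) = (1 + a) * v by ring]),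
    hφ.congr (u - a * v) (u + v) (by
      rwa [show u - a * v - (u + v) = -((1 + a) * v) by ring, norm_neg]), mul_comm]

/-- Here `v` is integral on the support, and 2v and 2av lie in the open unit ball, so each factor is
unchanged. -/
theorem heyde_eq_of_eq_two (hφ : IsEvenOnResidues φ) (hp : p = 2) (ha : ‖a‖ < 1) (u v : ℚ_[p]) :
    φ (u + v) * φ (u + a * v) = φ (u - v) * φ (u - a * v) := by
  refine mul_eq_mul_of_ne_zero (fun u v h1 h2 => ?_) u v
  have hv := hφ.norm_one_sub_mul_le h1 h2
  rw [norm_mul, Padic.norm_one_sub_eq_one ha, one_mul] at hv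
  have h2v : ‖2 * v‖ < 1 := by
    rw [norm_mul, Padic.norm_two_eq_inv hp]
    linarith
  rw [hφ.congr (u + v) (u - v) (by rwa [show u + v - (u - v) = 2 * v by ring]),
    hφ.congr (u + a * v) (u - a * v) (by
      rw [show u + a * v - (u - a * v) = a * (2 * v) by ring, norm_mul]
      exact mul_lt_one_of_nonneg_of_lt_one_left (norm_nonneg _) ha h2v.le)]

/-- On the support pv is integral, so two factors of p in `a` put av in the open unit ball. Then `u`
is integral and pu is negligible as well: the equation reduces to φ(pv)φ(u) = φ(-pv)φ(u), which is
evenness. -/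
theorem heyde_eq_of_norm_le_inv_sq (hφ : IsEvenOnResidues φ) (ha : ‖a‖ ≤ ((p : ℝ)⁻¹) ^ 2)
    (u v : ℚ_[p]) : φ (p * (u + v)) * φ (u + a * v) = φ (p * (u - v)) * φ (u - a * v) := by
  have hp1 : ‖(p : ℚ_[p])‖ < 1 := Padic.norm_p_lt_one
  have hp0 : 0 < ‖(p : ℚ_[p])‖ :=
    norm_pos_iff.2 (by exact_mod_cast (Fact.out : p.Prime).ne_zero)
  rw [← Padic.norm_p] at ha
  have ha1 : ‖a‖ < 1 := ha.trans_lt (pow_lt_one₀ hp0.le hp1 two_ne_zero)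
  refine mul_eq_mul_of_ne_zero (f := fun x : ℚ_[p] => φ (p * x)) (fun u v h1 h2 => ?_) u v
  have hu2 := hφ.norm_le _ h2
  have hpv : ‖p * v‖ ≤ 1 := by
    have := (Padic.nonarchimedean ((p : ℚ_[p]) * (u + v)) (-((p : ℚ_[p]) * (u + a * v)))).trans
      (max_le (hφ.norm_le _ h1) (by
        rw [norm_neg, norm_mul]; exact mul_le_one₀ hp1.le (norm_nonneg _) hu2))
    rwa [show p * (u + v) + -(p * (u + a * v)) = (1 - a) * (p * v) by ring, norm_mul,
      Padic.norm_one_sub_eq_one ha1, one_mul] at this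
  have hav : ‖a * v‖ < 1 := by
    calc ‖a * v‖ ≤ ‖(p : ℚ_[p])‖ ^ 2 * ‖v‖ := by rw [norm_mul]; gcongr
      _ = ‖(p : ℚ_[p])‖ * ‖p * v‖ := by rw [norm_mul]; ring
      _ < 1 := mul_lt_one_of_nonneg_of_lt_one_left hp0.le hp1 hpv
  have hu : ‖u‖ ≤ 1 := by
    have := (Padic.nonarchimedean (u + a * v) (-(a * v))).trans
      (max_le hu2 (by rw [norm_neg]; exact hav.le))
    rwa [add_neg_cancel_right] at this
  have hpu : ‖p * u‖ < 1 := by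
    rw [norm_mul]
    exact mul_lt_one_of_nonneg_of_lt_one_left hp0.le hp1 hu
  have h3 : φ (p * (u + v)) = φ (p * v) :=
    hφ.congr _ _ (by rwa [show p * (u + v) - p * v = p * u by ring])
  have h4 : φ (p * (u - v)) = φ (-(p * v)) :=
    hφ.congr _ _ (by rwa [show p * (u - v) - -(p * v) = p * u by ring])
  have h5 : φ (u + a * v) = φ u := hφ.congr _ _ (by rwa [add_sub_cancel_left])
  have h6 : φ (u - a * v) = φ u := hφ.congr _ _ (by rwa [sub_sub_cancel_left, norm_neg])
  simp only [h3, h4, h5, h6, hφ.neg]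

end IsEvenOnResidues

theorem exists_hasSymmetricCondDistrib {a : ℚ_[p]} {μ ν : Measure ℚ_[p]} [IsProbabilityMeasure μ]
    [IsProbabilityMeasure ν]
    (h : ∀ u v, padicCharFun μ (u + v) * padicCharFun ν (u + a * v) =
      padicCharFun μ (u - v) * padicCharFun ν (u - a * v))
    (hμ : ∃ y, padicCharFun μ y = 1 / 2) (hν : ∃ y, padicCharFun ν y = 1 / 2) :
    ∃ (Ω : Type) (_ : MeasurableSpace Ω) (P : Measure Ω) (_ : IsProbabilityMeasure P)
      (ξ₁ ξ₂ : Ω → ℚ_[p]), Measurable ξ₁ ∧ Measurable ξ₂ ∧ IndepFun ξ₁ ξ₂ P ∧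
      HasSymmetricCondDistrib P (fun ω => ξ₁ ω + a * ξ₂ ω) (fun ω => ξ₁ ω + ξ₂ ω) ∧
      ¬ IsIdempotentDistribution (P.map ξ₁) ∧ ¬ IsIdempotentDistribution (P.map ξ₂) := by
  have hfst : (μ.prod ν).map Prod.fst = μ := by simp
  have hsnd : (μ.prod ν).map Prod.snd = ν := by simp
  have hind : IndepFun Prod.fst Prod.snd (μ.prod ν) :=
    indepFun_prod measurable_id measurable_id
  have hnot : ∀ ρ : Measure ℚ_[p], (∃ y, padicCharFun ρ y = 1 / 2) →
      ¬ IsIdempotentDistribution ρ := by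
    rintro ρ ⟨y, hy⟩ hρ
    have := hρ.norm_padicCharFun y
    rw [hy] at this
    norm_num at this
  refine ⟨ℚ_[p] × ℚ_[p], inferInstance, μ.prod ν, inferInstance, Prod.fst, Prod.snd,
    measurable_fst, measurable_snd, hind, ?_, ?_, ?_⟩
  · rw [hasSymmetricCondDistrib_iff_padicCharFun _ measurable_fst measurable_snd hind, hfst, hsnd]
    exact h
  · rw [hfst]
    exact hnot μ hμ
  · rw [hsnd]
    exact hnot ν hν

theorem heyde_eq_symm {f g : ℚ_[p] → ℂ} {a : ℚ_[p]} (ha : a ≠ 0)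
    (h : ∀ u v, f (u + v) * g (u + a⁻¹ * v) = f (u - v) * g (u - a⁻¹ * v)) (u v : ℚ_[p]) :
    g (u + v) * f (u + a * v) = g (u - v) * f (u - a * v) := by
  have := h u (a * v)
  rw [inv_mul_cancel_left₀ ha] at this
  rw [mul_comm, this, mul_comm]

end Examples

end

/-! ### The theorem, case by case. -/

theorem theorem1 (p : ℕ) [Fact p.Prime] (α : ℚ_[p] ≃ₜ+ ℚ_[p]) (k : ℤ) (c : ℤ_[p]ˣ)
    (hα : ∀ x : ℚ_[p], α x = (p : ℚ_[p]) ^ k * ((c : ℤ_[p]) : ℚ_[p]) * x) :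
    (∀ (Ω : Type*) [MeasurableSpace Ω] (P : Measure Ω) [IsProbabilityMeasure P]
      (ξ₁ ξ₂ : Ω → ℚ_[p]), Measurable ξ₁ → Measurable ξ₂ → IndepFun ξ₁ ξ₂ P →
      HasSymmetricCondDistrib P (fun ω => ξ₁ ω + α (ξ₂ ω)) (fun ω => ξ₁ ω + ξ₂ ω) →
      (2 < p → k = 0 → padicDigit (c : ℤ_[p]) 0 ≠ p - 1 →
        (∃ (K : AddSubgroup ℚ_[p]) (_ : CompactSpace K) (x₁ x₂ : ℚ_[p]),
          P.map ξ₁ = haarDistribution K ∗ Measure.dirac x₁ ∧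
          P.map ξ₂ = haarDistribution K ∗ Measure.dirac x₂) ∧
        (padicDigit (c : ℤ_[p]) 0 = 1 →
          IsDegenerateDistribution (P.map ξ₁) ∧ IsDegenerateDistribution (P.map ξ₂))) ∧
      (p = 2 → k = 0 → padicDigit (c : ℤ_[p]) 0 = 1 → padicDigit (c : ℤ_[p]) 1 = 0 →
        IsDegenerateDistribution (P.map ξ₁) ∧ IsDegenerateDistribution (P.map ξ₂)) ∧
      (2 < p → |k| = 1 →
        IsIdempotentDistribution (P.map ξ₁) ∨ IsIdempotentDistribution (P.map ξ₂))) ∧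
    ((2 < p ∧ k = 0 ∧ padicDigit (c : ℤ_[p]) 0 = p - 1) ∨
      (p = 2 ∧ k = 0 ∧ padicDigit (c : ℤ_[p]) 0 = 1 ∧ padicDigit (c : ℤ_[p]) 1 = 1) ∨
      (p = 2 ∧ |k| = 1) ∨
      2 ≤ |k| →
      ∃ (Ω : Type) (_ : MeasurableSpace Ω) (P : Measure Ω) (_ : IsProbabilityMeasure P)
        (ξ₁ ξ₂ : Ω → ℚ_[p]), Measurable ξ₁ ∧ Measurable ξ₂ ∧ IndepFun ξ₁ ξ₂ P ∧
        HasSymmetricCondDistrib P (fun ω => ξ₁ ω + α (ξ₂ ω)) (fun ω => ξ₁ ω + ξ₂ ω) ∧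
        ¬ IsIdempotentDistribution (P.map ξ₁) ∧ ¬ IsIdempotentDistribution (P.map ξ₂)) := by
  have hprime := (Fact.out : p.Prime)
  have hc : ‖((c : ℤ_[p]) : ℚ_[p])‖ = 1 := by
    rw [← PadicInt.norm_def]; exact PadicInt.norm_units c
  have hp0 : (p : ℚ_[p]) ≠ 0 := by exact_mod_cast hprime.ne_zero
  set a : ℚ_[p] := (p : ℚ_[p]) ^ k * ((c : ℤ_[p]) : ℚ_[p]) with ha
  have ha0 : a ≠ 0 := mul_ne_zero (zpow_ne_zero k hp0) (norm_pos_iff.1 (by rw [hc]; exact one_pos))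
  have hanorm : ‖a‖ = (p : ℝ) ^ (-k) := by rw [ha, norm_mul, hc, mul_one, Padic.norm_p_zpow]
  have hak : k = 0 → a = ((c : ℤ_[p]) : ℚ_[p]) := by
    rintro hk
    rw [ha, hk, zpow_zero, one_mul]
  simp only [hα]
  constructor
  · intro Ω _ P _ ξ₁ ξ₂ h₁ h₂ hind hsym
    have := Measure.isProbabilityMeasure_map (μ := P) h₁.aemeasurable
    have := Measure.isProbabilityMeasure_map (μ := P) h₂.aemeasurable
    have H := heydePair_norm_padicCharFun
      ((hasSymmetricCondDistrib_iff_padicCharFun P h₁ h₂ hind a).1 hsym)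
    refine ⟨fun hp hk hdig => ⟨?_, fun hdig1 => ?_⟩, fun hp hk h0 h1 => ?_, fun hp hk => ?_⟩
    · have h1a : ‖1 + a‖ = 1 := by
        rw [hak hk]
        refine le_antisymm ?_ (not_lt.1 fun h => hdig ((padicDigit_zero_eq_sub_one_iff _).2 h))
        refine (Padic.nonarchimedean _ _).trans (max_le norm_one.le hc.le)
      have key := H.eq_one_of_norm_eq_one hp (by rw [hak hk, hc]) h1a
      -- Equal sets of modulus one have the same annihilator, hence both distributions use the same
      -- subgroup `K`.
      have hset : {y | ‖padicCharFun (P.map ξ₁) y‖ = 1} =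
          {y | ‖padicCharFun (P.map ξ₂) y‖ = 1} :=
        Set.ext fun y => ⟨fun (h : _ = _) => (key y).1 (by rw [h]; exact one_ne_zero),
          fun (h : _ = _) => (key y).2 (by rw [h]; exact one_ne_zero)⟩
      obtain ⟨hK, x₁, hx₁⟩ := eq_haarDistribution_conv_dirac (μ := P.map ξ₁) fun y hy =>
        (key y).2 (by rw [(key y).1 (norm_ne_zero_iff.2 hy)]; exact one_ne_zero)
      obtain ⟨hK', x₂, hx₂⟩ := eq_haarDistribution_conv_dirac (μ := P.map ξ₂) fun y hy =>
        (key y).1 (by rw [(key y).2 (norm_ne_zero_iff.2 hy)]; exact one_ne_zero)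
      simp only [← hset] at hx₂
      exact ⟨_, hK, x₁, x₂, hx₁, hx₂⟩
    · have h1 := (padicDigit_zero_eq_iff _ hprime.one_lt).1 hdig1
      have h1a : ‖1 + a‖ = 1 := by
        rw [hak hk, show 1 + ((c : ℤ_[p]) : ℚ_[p]) = 2 + ((c : ℤ_[p]) - (1 : ℕ)) by
          push_cast; ring, Padic.add_eq_max_of_ne, Padic.norm_two_eq_one hp, max_eq_left h1.le]
        rw [Padic.norm_two_eq_one hp]
        exact h1.ne'
      have key := H.eq_one_of_norm_one_sub_lt_one h1a (by
        rw [hak hk, norm_sub_rev]; exact_mod_cast h1)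
      exact ⟨isDegenerateDistribution_of_norm_padicCharFun_eq_one fun y => (key y).1,
        isDegenerateDistribution_of_norm_padicCharFun_eq_one fun y => (key y).2⟩
    · have key := H.eq_one_of_norm_sub_one_le hp (by
        simpa [hak hk] using norm_sub_le_of_padicDigit hp h0 h1)
      exact ⟨isDegenerateDistribution_of_norm_padicCharFun_eq_one fun y => (key y).1,
        isDegenerateDistribution_of_norm_padicCharFun_eq_one fun y => (key y).2⟩
    · have hidem : ∀ μ : Measure ℚ_[p], IsProbabilityMeasure μ →
          (∀ y, ‖padicCharFun μ y‖ ≠ 0 → ‖padicCharFun μ y‖ = 1) →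
          IsIdempotentDistribution μ := by
        intro μ _ h
        obtain ⟨hK, x, hx⟩ := eq_haarDistribution_conv_dirac fun y hy =>
          h y (norm_ne_zero_iff.2 hy)
        exact ⟨_, hK, x, hx⟩
      -- For `k = 1` the norm of `a` is `p⁻¹`; for `k = -1` that of `a⁻¹` is, and the two
      -- distributions exchange roles.
      rcases (abs_eq one_pos.le).1 hk with rfl | rfl
      · exact (H.left_or_right_eq_one_of_norm_eq_inv hp (by simpa using hanorm)).imp
          (hidem _ inferInstance) (hidem _ inferInstance)
      · exact ((H.symm ha0).left_or_right_eq_one_of_norm_eq_inv hp (by simp [hanorm])).symm.imp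
          (hidem _ inferInstance) (hidem _ inferInstance)
  · intro hcases
    obtain ⟨μ, hμ, hφ, hφ1⟩ := exists_isEvenOnResidues_padicCharFun p
    have hhalf : ∃ y, padicCharFun μ y = 1 / 2 := ⟨1, hφ1⟩
    rcases hcases with ⟨hp, hk, hdig⟩ | ⟨hp, hk, h0, h1⟩ | ⟨hp, hk⟩ | hk
    · have hlt := (padicDigit_zero_eq_sub_one_iff _).1 hdig
      rw [← hak hk] at hlt
      refine exists_hasSymmetricCondDistrib (hφ.heyde_eq_of_norm_one_add_lt ?_) hhalf hhalf
      have : ‖1 - a‖ = 1 := by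
        rw [show 1 - a = 2 + -(1 + a) by ring, Padic.add_eq_max_of_ne, norm_neg,
          Padic.norm_two_eq_one hp, max_eq_left hlt.le]
        rw [norm_neg, Padic.norm_two_eq_one hp]
        exact hlt.ne'
      rwa [this]
    · have h2 := Padic.norm_two_eq_inv hp
      have hle : ‖1 + a‖ ≤ 4⁻¹ := by
        have h3 := norm_sub_le_of_padicDigit hp h0 h1
        rw [← hak hk] at h3
        have h4 : ‖(4 : ℚ_[p])‖ = 4⁻¹ := by
          rw [show (4 : ℚ_[p]) = 2 * 2 by norm_num, norm_mul, h2]; norm_num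
        -- Here `a` is 3 modulo 4, and 1 + a = (a - 3) + 4.
        have := (Padic.nonarchimedean (a - (1 + 2 * ((1 : ℕ) : ℚ_[p]))) 4).trans (max_le h3 h4.le)
        rwa [show a - (1 + 2 * ((1 : ℕ) : ℚ_[p])) + 4 = 1 + a by push_cast; ring] at this
      refine exists_hasSymmetricCondDistrib (hφ.heyde_eq_of_norm_one_add_lt ?_) hhalf hhalf
      have hlt : ‖1 + a‖ < 2⁻¹ := hle.trans_lt (by norm_num)
      have : ‖1 - a‖ = 2⁻¹ := by
        rw [show 1 - a = 2 + -(1 + a) by ring, Padic.add_eq_max_of_ne, norm_neg, h2,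
          max_eq_left hlt.le]
        rw [norm_neg, h2]
        exact hlt.ne'
      rwa [this]
    · rcases (abs_eq one_pos.le).1 hk with rfl | rfl
      · refine exists_hasSymmetricCondDistrib (hφ.heyde_eq_of_eq_two hp ?_) hhalf hhalf
        rw [hanorm, hp]; norm_num
      · refine exists_hasSymmetricCondDistrib
          (heyde_eq_symm ha0 (hφ.heyde_eq_of_eq_two hp ?_)) hhalf hhalf
        rw [norm_inv, hanorm, hp]; norm_num
    -- Dilating the distribution by p dilates the argument of its characteristic function. The sign
    -- of `k` decides which of the two distributions is dilated.
    · have hmap : ∀ y, padicCharFun (μ.map fun x => p * x) y = padicCharFun μ (p * y) := by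
        intro y
        rw [padicCharFun_map _ (measurable_const_mul _), padicCharFun]
        exact integral_congr_ae (Filter.Eventually.of_forall fun x =>
          congrArg (fun t => (padicChar p t : ℂ)) (by ring))
      have := Measure.isProbabilityMeasure_map (μ := μ)
        (measurable_const_mul (p : ℚ_[p])).aemeasurable
      have hhalf' : ∃ y, padicCharFun (μ.map fun x => p * x) y = 1 / 2 :=
        ⟨(p : ℚ_[p])⁻¹, by rw [hmap, mul_inv_cancel₀ hp0, hφ1]⟩
      have hp1 : (1 : ℝ) ≤ p := by exact_mod_cast hprime.one_le
      have hpow : ∀ m : ℤ, 2 ≤ m → (p : ℝ) ^ (-m) ≤ ((p : ℝ)⁻¹) ^ 2 := by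
        intro m hm
        calc (p : ℝ) ^ (-m) ≤ (p : ℝ) ^ (-2 : ℤ) := zpow_le_zpow_right₀ hp1 (by omega)
          _ = ((p : ℝ)⁻¹) ^ 2 := by rw [zpow_neg, inv_pow]; norm_cast
      rcases le_abs.1 hk with hk | hk
      · refine exists_hasSymmetricCondDistrib (μ := μ.map fun x => p * x) (fun u v => ?_) hhalf'
          hhalf
        rw [hmap, hmap]
        exact hφ.heyde_eq_of_norm_le_inv_sq (hanorm ▸ hpow k hk) u v
      · refine exists_hasSymmetricCondDistrib (ν := μ.map fun x => p * x)
          (heyde_eq_symm ha0 fun u v => ?_) hhalf hhalf'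
        rw [hmap, hmap]
        refine hφ.heyde_eq_of_norm_le_inv_sq ?_ u v
        rw [norm_inv, hanorm, ← zpow_neg]
        exact hpow (-k) hk
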